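/- Let $p,q$ be coprime integers with $|p|+|q|>2$, let $A\in M_n(\mathbb C)$, and let $m\sigma(A)$ be the multiset of eigenvalues of $A$, counted with algebraic multiplicity. For a multiset $U$ of complex numbers, $U^p$ denotes the multiset of the $p$-th powers of its elements, with multiplicities. Assume that $(m\sigma(A))^p=(m\sigma(A))^q$. We write $X\sim Y$ when the square matrices $X,Y$ are similar over $\mathbb C$. For an eigenvalue $\lambda$ of an invertible matrix $A$ as above, the orbit of $\lambda$ is the set of terms of the (unique) sequence $(\lambda_i)_{i\in\mathbb Z}$ of eigenvalues of $A$ such that $\lambda_1=\lambda$ and $\lambda_i^q=\lambda_{i+1}^p$ for all $i\in\mathbb Z$. Let $O_1,\dots,O_\tau$ be the distinct orbits. All elements of $O_j$ have the same multiplicity in $m\sigma(A)$, which is denoted by $r_j$. (i) Suppose that $A$ is invertible. Then $A$ has a Jordan decomposition $$A=P\,\mathrm{diag}(\lambda_1I_{i_1}+N_1,\dots,\lambda_mI_{i_m}+N_m)\,P^{-1},$$ where $P$ is invertible, $\lambda_1,\dots,\lambda_m$ are the pairwise distinct eigenvalues of $A$, and each $N_k\in M_{i_k}(\mathbb C)$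 (with $i_k\ge 1$) is a block diagonal matrix of nilpotent Jordan blocks. For every such decomposition, $A^p\sim A^q$ if and only if, for every $j\le\tau$ and all $\lambda_k,\lambda_l\in O_j$, one has $i_k=i_l=r_j$ and $N_k=N_l$ up to the order of their Jordan blocks. (ii) Suppose that $A$ is not invertible and $1\le p<q$. Then $A^p\sim A^q$ if and only if there are integers $m,k\ge 0$ with $m+k=n$, an invertible matrix $P\in M_n(\mathbb C)$, an invertible matrix $A'\in M_m(\mathbb C)$ and a matrix $N\in M_k(\mathbb C)$ with $$A=P\,\mathrm{diag}(A',N)\,P^{-1},\qquad N^p=0,$$ such that $(m\sigma(A'))^p=(m\sigma(A'))^q$ and $A'$ has a Jordan decomposition that satisfies the condition in (i), with respect to the orbits of eigenvalues of $A'$. -/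

import Mathlib

/-- `s` is a two-sided sequence of elements of `U` with `s i ^ q = s (i + 1) ^ p` for all `i`. -/
def IsOrbitSeq (p q : ℤ) (U : Multiset ℂ) (s : ℤ → ℂ) : Prop :=
  ∀ i : ℤ, s i ∈ U ∧ s i ^ q = s (i + 1) ^ p

/-- The orbit of `x`: all the terms of the two-sided sequence of elements of `U` whose term of
index `1` is `x`, i.e. the orbit of `x` under the action `(k, s 1) ↦ s (k + 1)` of `ℤ`. -/
def powerOrbit (p q : ℤ) (U : Multiset ℂ) (x : ℂ) : Set ℂ :=
  {y | ∃ s : ℤ → ℂ, IsOrbitSeq p q U s ∧ s 1 = x ∧ ∃ k : ℤ, s (k + 1) = y}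

/-- The set of distinct orbits of elements of `U`. -/
def powerOrbits (p q : ℤ) (U : Multiset ℂ) : Set (Set ℂ) :=
  {O | ∃ x ∈ U, O = powerOrbit p q U x}

/-- The multiset of the eigenvalues of `A` with their (algebraic) multiplicities. -/
noncomputable def eigenMultiset {n : ℕ} (A : Matrix (Fin n) (Fin n) ℂ) : Multiset ℂ :=
  A.charpoly.roots

/-- The nilpotent Jordan block of dimension `d` (ones on the superdiagonal). -/
def nilpotentJordanBlock (d : ℕ) : Matrix (Fin d) (Fin d) ℂ :=
  Matrix.of fun i j => if (i : ℕ) + 1 = (j : ℕ) then 1 else 0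

/-- The block diagonal matrix whose diagonal blocks are the nilpotent Jordan blocks of the
dimensions listed in `L`, in this order. -/
def nilpotentJordanMatrix (L : List ℕ) :
    Matrix (Σ b : Fin L.length, Fin (L.get b)) (Σ b : Fin L.length, Fin (L.get b)) ℂ :=
  Matrix.blockDiagonal' fun b => nilpotentJordanBlock (L.get b)

/-- The combinatorial data of a Jordan normal form: pairwise distinct numbers `ev k` and, for each
of them, a nonempty list of positive dimensions of nilpotent Jordan blocks. -/
structure JordanData where
  m : ℕ
  ev : Fin m → ℂ
  ev_injective : Function.Injective ev
  blocks : Fin m → List ℕ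
  blocks_ne_nil : ∀ k, blocks k ≠ []
  blocks_pos : ∀ k, ∀ d ∈ blocks k, 0 < d

namespace JordanData

/-- The index set of the part belonging to `ev k`. -/
abbrev PartIdx (D : JordanData) (k : Fin D.m) : Type :=
  Σ b : Fin (D.blocks k).length, Fin ((D.blocks k).get b)

/-- The index set of the rows and columns of the Jordan normal form. -/
abbrev Idx (D : JordanData) : Type :=
  Σ k : Fin D.m, D.PartIdx k

/-- The dimension `i_k` of the part belonging to `ev k`. -/
def dim (D : JordanData) (k : Fin D.m) : ℕ :=
  (D.blocks k).sum

/-- The nilpotent Jordan matrix `N_k`. -/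
def nilpotentPart (D : JordanData) (k : Fin D.m) : Matrix (D.PartIdx k) (D.PartIdx k) ℂ :=
  nilpotentJordanMatrix (D.blocks k)

/-- The matrix `diag(ev 1 • 1 + N_1, …, ev m • 1 + N_m)`. -/
def toMatrix (D : JordanData) : Matrix D.Idx D.Idx ℂ :=
  Matrix.blockDiagonal' fun k =>
    D.ev k • (1 : Matrix (D.PartIdx k) (D.PartIdx k) ℂ) + D.nilpotentPart k

end JordanData

/-- A decomposition `A = P diag(ev 1 • 1 + N_1, …, ev m • 1 + N_m) P⁻¹` of `A` in Jordan normal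
form. The equivalence `e` only identifies the index set of the block matrix with `Fin n`. -/
structure JordanDecomposition {n : ℕ} (A : Matrix (Fin n) (Fin n) ℂ) extends JordanData where
  e : toJordanData.Idx ≃ Fin n
  P : GL (Fin n) ℂ
  eq_conj : A = (P : Matrix (Fin n) (Fin n) ℂ) * Matrix.reindex e e toJordanData.toMatrix *
    ((P⁻¹ : GL (Fin n) ℂ) : Matrix (Fin n) (Fin n) ℂ)

/-- For every orbit `O` of eigenvalues of `A`, with multiplicity `r` in the multiset of
eigenvalues, and for all eigenvalues `ev k`, `ev l` in `O`, one has `i_k = i_l = r`, and `N_k` and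
`N_l` have the same Jordan blocks up to their order. -/
def JordanDecomposition.UniformOnOrbits {n : ℕ} {A : Matrix (Fin n) (Fin n) ℂ}
    (J : JordanDecomposition A) (p q : ℤ) : Prop :=
  ∀ O ∈ powerOrbits p q (eigenMultiset A), ∃ r : ℕ,
    (∀ x ∈ O, (eigenMultiset A).count x = r) ∧
    ∀ k l : Fin J.m, J.ev k ∈ O → J.ev l ∈ O →
      J.dim k = r ∧ J.dim l = r ∧ (J.blocks k).Perm (J.blocks l)

open Matrix Polynomial

/-! Complex matrices are similar exactly when dim ker (A - μ)^k agree for all μ and k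
(`Matrix.intertwined_iff_kerDim`), and these numbers determine the Jordan block sizes. So both parts
become statements about `kerDim`.

Let A be invertible. The multiset hypothesis gives a permutation σ of the eigenvalue list with λ_i^q
= λ_{σ i}^p. Iterating N = ord σ times shows x^(q^N - p^N) = 1 for each eigenvalue x. As p is
coprime to q^N - p^N, the map x ↦ x^p is injective on eigenvalues, and likewise x ↦ x^q
(`injOn_zpow_of_map_zpow_eq`). Injectivity makes the kernel dimensions of A^p at x^p those of A at x
(`kerDim_zpow`). Hence A^p ~ A^q iff the kernel dimensions of A agree at x and y whenever x^q = y^p,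
that is, iff they are constant along orbits. Multiplicities are constant along orbits in any case.

If A is singular, split it as diag(A', N) with A' invertible and N nilpotent. Comparing dim ker A^p
with dim ker A^q for p < q bounds the blocks of N by p, so N^p = 0. Conversely N^p = N^q = 0
contributes equally to both powers, and only A' matters. -/

/-- Two complex square matrices, possibly with different index types, represent the same
endomorphism up to a linear equivalence. -/
def Matrix.Intertwined {m n : Type*} [Fintype m] [Fintype n] (A : Matrix n n ℂ)
    (B : Matrix m m ℂ) : Prop :=
  ∃ φ : (m → ℂ) ≃ₗ[ℂ] (n → ℂ), ∀ v, φ (B *ᵥ v) = A *ᵥ φ v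

/-- The dimension of the kernel of `(A - μ • 1) ^ k`. -/
noncomputable def Matrix.kerDim {n : Type*} [Fintype n] [DecidableEq n] (A : Matrix n n ℂ)
    (μ : ℂ) (k : ℕ) : ℕ :=
  Module.finrank ℂ (LinearMap.ker ((A - μ • (1 : Matrix n n ℂ)) ^ k).mulVecLin)

namespace Matrix

/-! ### Similarity across different index types. -/

section Intertwined

variable {l m n : Type*} [Fintype l] [Fintype m] [Fintype n]

theorem Intertwined.symm {A : Matrix n n ℂ} {B : Matrix m m ℂ} (h : Intertwined A B) :
    Intertwined B A := by
  obtain ⟨φ, hφ⟩ := h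
  refine ⟨φ.symm, fun v => ?_⟩
  rw [LinearEquiv.symm_apply_eq, hφ, LinearEquiv.apply_symm_apply]

theorem Intertwined.trans {A : Matrix n n ℂ} {B : Matrix m m ℂ} {C : Matrix l l ℂ}
    (h : Intertwined A B) (h' : Intertwined B C) : Intertwined A C := by
  obtain ⟨φ, hφ⟩ := h
  obtain ⟨ψ, hψ⟩ := h'
  exact ⟨ψ.trans φ, fun v => by simp [hψ, hφ]⟩

theorem intertwined_reindex (e : m ≃ n) (B : Matrix m m ℂ) :
    Intertwined (reindex e e B) B := by
  refine ⟨LinearEquiv.funCongrLeft ℂ ℂ e.symm, fun v => ?_⟩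
  ext i
  simp only [LinearEquiv.funCongrLeft_apply, LinearMap.funLeft_apply, mulVec, dotProduct,
    reindex_apply, submatrix_apply]
  exact (e.symm.sum_comp fun x => B (e.symm i) x * v x).symm

theorem intertwined_conj [DecidableEq n] (P : GL n ℂ) (B : Matrix n n ℂ) :
    Intertwined ((P : Matrix n n ℂ) * B * ((P⁻¹ : GL n ℂ) : Matrix n n ℂ)) B := by
  refine ⟨LinearEquiv.ofLinearMap (P : Matrix n n ℂ).mulVecLin
    ((P⁻¹ : GL n ℂ) : Matrix n n ℂ).mulVecLin ?_ ?_, fun v => ?_⟩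
  · rw [← mulVecLin_mul, ← Units.val_mul]; simp
  · rw [← mulVecLin_mul, ← Units.val_mul]; simp
  · simp [mul_assoc]

theorem Intertwined.exists_conj [DecidableEq m] [DecidableEq n] {A : Matrix n n ℂ}
    {B : Matrix m m ℂ} (h : Intertwined A B) (e : m ≃ n) :
    ∃ P : GL n ℂ, A = (P : Matrix n n ℂ) * reindex e e B * ((P⁻¹ : GL n ℂ) : Matrix n n ℂ) := by
  obtain ⟨φ, hφ⟩ := h.trans (intertwined_reindex e B).symm
  refine ⟨⟨LinearMap.toMatrix' φ.toLinearMap, LinearMap.toMatrix' φ.symm.toLinearMap, ?_, ?_⟩, ?_⟩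
  · rw [← LinearMap.toMatrix'_comp]; simp
  · rw [← LinearMap.toMatrix'_comp]; simp
  · have key : A * LinearMap.toMatrix' φ.toLinearMap
        = LinearMap.toMatrix' φ.toLinearMap * reindex e e B := by
      apply toLin'.injective
      refine LinearMap.ext fun x => ?_
      rw [toLin'_mul, toLin'_mul, toLin'_toMatrix']
      exact (hφ x).symm
    change A = LinearMap.toMatrix' φ.toLinearMap * reindex e e B *
      LinearMap.toMatrix' φ.symm.toLinearMap
    rw [← key, mul_assoc, ← LinearMap.toMatrix'_comp]
    simp

theorem Intertwined.card_eq {A : Matrix n n ℂ} {B : Matrix m m ℂ} (h : Intertwined A B) :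
    Fintype.card m = Fintype.card n := by
  obtain ⟨φ, -⟩ := h
  simpa using φ.finrank_eq

theorem isConj_iff_intertwined [DecidableEq n] {A B : Matrix n n ℂ} :
    IsConj A B ↔ Intertwined A B := by
  constructor
  · rintro ⟨c, hc⟩
    have : B = (c : Matrix n n ℂ) * A * ((c⁻¹ : GL n ℂ) : Matrix n n ℂ) := by
      rw [hc.eq, mul_assoc, ← Units.val_mul]; simp
    rw [this]
    exact (intertwined_conj c A).symm
  · intro h
    obtain ⟨P, hP⟩ := h.exists_conj (Equiv.refl n)
    refine IsConj.symm ⟨P, ?_⟩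
    rw [hP]
    simp [SemiconjBy, mul_assoc]

theorem Intertwined.sub_smul_one [DecidableEq m] [DecidableEq n] {A : Matrix n n ℂ}
    {B : Matrix m m ℂ} (h : Intertwined A B) (μ : ℂ) :
    Intertwined (A - μ • (1 : Matrix n n ℂ)) (B - μ • (1 : Matrix m m ℂ)) := by
  obtain ⟨φ, hφ⟩ := h
  exact ⟨φ, fun v => by simp [sub_mulVec, hφ, smul_mulVec]⟩

theorem Intertwined.pow [DecidableEq m] [DecidableEq n] {A : Matrix n n ℂ}
    {B : Matrix m m ℂ} (h : Intertwined A B) (k : ℕ) : Intertwined (A ^ k) (B ^ k) := by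
  obtain ⟨φ, hφ⟩ := h
  refine ⟨φ, fun v => ?_⟩
  induction k generalizing v with
  | zero => simp
  | succ k ih => simp [pow_succ, ← mulVec_mulVec, hφ, ih]

theorem Intertwined.finrank_ker_eq {A : Matrix n n ℂ} {B : Matrix m m ℂ} (h : Intertwined A B) :
    Module.finrank ℂ (LinearMap.ker A.mulVecLin) = Module.finrank ℂ (LinearMap.ker B.mulVecLin) := by
  obtain ⟨φ, hφ⟩ := h
  refine (LinearEquiv.finrank_eq (φ.ofSubmodules _ _ ?_)).symm
  ext v
  simp only [Submodule.mem_map, LinearMap.mem_ker, mulVecLin_apply]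
  constructor
  · rintro ⟨w, hw, rfl⟩
    simpa [hw] using (hφ w).symm
  · intro hv
    refine ⟨φ.symm v, ?_, by simp⟩
    apply φ.injective
    simp [hφ, hv]

theorem Intertwined.kerDim_eq [DecidableEq m] [DecidableEq n] {A : Matrix n n ℂ}
    {B : Matrix m m ℂ} (h : Intertwined A B) (μ : ℂ) (k : ℕ) : A.kerDim μ k = B.kerDim μ k :=
  ((h.sub_smul_one μ).pow k).finrank_ker_eq

end Intertwined

/-! ### Kernel dimensions of powers of A - μ. -/

section kerDim

variable {m n : Type*} [Fintype m] [DecidableEq m] [Fintype n] [DecidableEq n]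

theorem finrank_ker_mul_of_isUnit {M g : Matrix n n ℂ} (hg : IsUnit g) (hc : Commute M g) :
    Module.finrank ℂ (LinearMap.ker (M * g).mulVecLin)
      = Module.finrank ℂ (LinearMap.ker M.mulVecLin) := by
  have : LinearMap.ker (M * g).mulVecLin = LinearMap.ker M.mulVecLin := by
    ext v
    rw [hc.eq]
    simp only [LinearMap.mem_ker, mulVecLin_apply, ← mulVec_mulVec]
    exact ⟨fun h => mulVec_injective_of_isUnit hg (by simpa using h), fun h => by simp [h]⟩
  rw [this]

/-- An invertible factor commuting with A - μ does not change the kernel of any power. Inverses and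
powers of matrices are both handled through this factorization. -/
theorem kerDim_eq_of_sub_eq_mul {A B g : Matrix n n ℂ} {μ ν : ℂ} (hg : IsUnit g)
    (hc : Commute A g) (h : B - ν • (1 : Matrix n n ℂ) = (A - μ • (1 : Matrix n n ℂ)) * g) (k : ℕ) :
    B.kerDim ν k = A.kerDim μ k := by
  have hc' : Commute (A - μ • (1 : Matrix n n ℂ)) g :=
    hc.sub_left ((Commute.one_left g).smul_left μ)
  rw [kerDim, kerDim, h, hc'.mul_pow]
  exact finrank_ker_mul_of_isUnit (hg.pow k) (hc'.pow_pow k k)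

theorem isUnit_sub_smul_one_iff {A : Matrix n n ℂ} {μ : ℂ} :
    IsUnit (A - μ • (1 : Matrix n n ℂ)) ↔ μ ∉ spectrum ℂ A := by
  rw [spectrum.notMem_iff, Algebra.algebraMap_eq_smul_one, IsUnit.sub_iff]

theorem kerDim_one_eq_zero_iff {A : Matrix n n ℂ} {μ : ℂ} :
    A.kerDim μ 1 = 0 ↔ μ ∉ spectrum ℂ A := by
  rw [← isUnit_sub_smul_one_iff, kerDim, pow_one, Submodule.finrank_eq_zero,
    LinearMap.ker_eq_bot, ← mulVec_injective_iff_isUnit]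
  rfl

theorem kerDim_eq_zero_of_notMem_spectrum {A : Matrix n n ℂ} {μ : ℂ} (h : μ ∉ spectrum ℂ A)
    (k : ℕ) : A.kerDim μ k = 0 := by
  rw [kerDim, Submodule.finrank_eq_zero, LinearMap.ker_eq_bot]
  exact mulVec_injective_of_isUnit ((isUnit_sub_smul_one_iff.2 h).pow k)

theorem kerDim_zero_left (A : Matrix n n ℂ) (k : ℕ) :
    A.kerDim 0 k = Module.finrank ℂ (LinearMap.ker (A ^ k).mulVecLin) := by
  rw [kerDim, zero_smul, sub_zero]

theorem kerDim_pow_zero_one (A : Matrix n n ℂ) (k : ℕ) : (A ^ k).kerDim 0 1 = A.kerDim 0 k := by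
  rw [kerDim_zero_left, kerDim_zero_left, pow_one]

theorem kerDim_zero_eq_card_iff {A : Matrix n n ℂ} {k : ℕ} :
    A.kerDim 0 k = Fintype.card n ↔ A ^ k = 0 := by
  rw [kerDim_zero_left, ← Module.finrank_fintype_fun_eq_card ℂ]
  constructor
  · intro h
    have := Submodule.eq_top_of_finrank_eq h
    rw [LinearMap.ker_eq_top] at this
    apply toLin'.injective
    rw [map_zero]
    exact this
  · intro h
    rw [h, mulVecLin_zero, LinearMap.ker_zero, finrank_top]

theorem blockDiagonal'_mulVec {ι : Type*} [Fintype ι] [DecidableEq ι] {d : ι → Type*}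
    [∀ i, Fintype (d i)] (M : ∀ i, Matrix (d i) (d i) ℂ) (v : (Σ i, d i) → ℂ) (i : ι) (j : d i) :
    (blockDiagonal' M *ᵥ v) ⟨i, j⟩ = (M i *ᵥ fun x => v ⟨i, x⟩) j := by
  simp only [mulVec, dotProduct]
  rw [Fintype.sum_sigma, Finset.sum_eq_single i]
  · simp
  · intro b _ hb
    exact Finset.sum_eq_zero fun x _ => by rw [blockDiagonal'_apply_ne _ _ _ hb.symm, zero_mul]
  · simp

theorem kerDim_blockDiagonal' {ι : Type*} [Fintype ι] [DecidableEq ι] {d : ι → Type*}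
    [∀ i, Fintype (d i)] [∀ i, DecidableEq (d i)] (M : ∀ i, Matrix (d i) (d i) ℂ) (μ : ℂ) (k : ℕ) :
    (blockDiagonal' M).kerDim μ k = ∑ i, (M i).kerDim μ k := by
  have h1 : (blockDiagonal' M - μ • (1 : Matrix (Σ i, d i) (Σ i, d i) ℂ)) ^ k
      = blockDiagonal' fun i => (M i - μ • (1 : Matrix (d i) (d i) ℂ)) ^ k := by
    rw [← blockDiagonal'_one, ← blockDiagonal'_smul, ← blockDiagonal'_sub, ← blockDiagonal'_pow]
    rfl
  simp only [kerDim]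
  rw [h1]
  set N := fun i => (M i - μ • (1 : Matrix (d i) (d i) ℂ)) ^ k
  rw [← Module.finrank_pi_fintype ℂ]
  refine LinearEquiv.finrank_eq
    { toFun := fun v i => ⟨fun x => v.1 ⟨i, x⟩, ?_⟩
      map_add' := fun _ _ => rfl
      map_smul' := fun _ _ => rfl
      invFun := fun w => ⟨fun x => (w x.1).1 x.2, ?_⟩
      left_inv := fun _ => rfl
      right_inv := fun _ => rfl }
  · have := v.2
    rw [LinearMap.mem_ker, mulVecLin_apply] at this ⊢
    ext j
    exact (blockDiagonal'_mulVec N v.1 i j).symm.trans (congrFun this ⟨i, j⟩)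
  · rw [LinearMap.mem_ker, mulVecLin_apply]
    ext ⟨i, j⟩
    rw [blockDiagonal'_mulVec]
    exact congrFun (w i).2 j

theorem kerDim_fromBlocks (A : Matrix m m ℂ) (B : Matrix n n ℂ) (μ : ℂ) (k : ℕ) :
    (fromBlocks A 0 0 B).kerDim μ k = A.kerDim μ k + B.kerDim μ k := by
  have h1 : (fromBlocks A 0 0 B - μ • (1 : Matrix (m ⊕ n) (m ⊕ n) ℂ)) ^ k
      = fromBlocks ((A - μ • (1 : Matrix m m ℂ)) ^ k) 0 0 ((B - μ • (1 : Matrix n n ℂ)) ^ k) := by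
    rw [← fromBlocks_one, fromBlocks_smul, sub_eq_add_neg, fromBlocks_neg, fromBlocks_add, ← fromBlocks_diagonal_pow]
    simp [sub_eq_add_neg]
  simp only [kerDim]
  rw [h1, ← Module.finrank_prod]
  refine LinearEquiv.finrank_eq
    { toFun := fun v => (⟨v.1 ∘ Sum.inl, ?_⟩, ⟨v.1 ∘ Sum.inr, ?_⟩)
      map_add' := fun _ _ => rfl
      map_smul' := fun _ _ => rfl
      invFun := fun w => ⟨Sum.elim w.1.1 w.2.1, ?_⟩
      left_inv := fun v => by simp
      right_inv := fun _ => rfl }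
  · have := v.2
    rw [LinearMap.mem_ker, mulVecLin_apply, fromBlocks_mulVec] at this
    ext i
    simpa using congrFun this (Sum.inl i)
  · have := v.2
    rw [LinearMap.mem_ker, mulVecLin_apply, fromBlocks_mulVec] at this
    ext i
    simpa using congrFun this (Sum.inr i)
  · have h1 := w.1.2
    have h2 := w.2.2
    rw [LinearMap.mem_ker, mulVecLin_apply] at h1 h2 ⊢
    rw [fromBlocks_mulVec]
    ext (i | i) <;> simp [h1, h2]

end kerDim

end Matrix

/-! ### Jordan blocks and their direct sums. -/

theorem nilpotentJordanBlock_mulVec {d : ℕ} (v : Fin d → ℂ) (i : Fin d) :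
    (nilpotentJordanBlock d *ᵥ v) i = if h : (i : ℕ) + 1 < d then v ⟨i + 1, h⟩ else 0 := by
  simp only [mulVec, dotProduct, nilpotentJordanBlock, of_apply, ite_mul, one_mul, zero_mul]
  split_ifs with h
  · rw [Finset.sum_eq_single ⟨i + 1, h⟩]
    · simp
    · intro j _ hj
      exact if_neg fun h' => hj (Fin.ext h'.symm)
    · simp
  · exact Finset.sum_eq_zero fun j _ => if_neg fun h' => h (by omega)

theorem nilpotentJordanBlock_pow_mulVec {d : ℕ} (k : ℕ) (v : Fin d → ℂ) (i : Fin d) :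
    (nilpotentJordanBlock d ^ k *ᵥ v) i = if h : (i : ℕ) + k < d then v ⟨i + k, h⟩ else 0 := by
  induction k generalizing v with
  | zero => simp
  | succ k ih =>
    rw [pow_succ, ← mulVec_mulVec, ih]
    by_cases h : (i : ℕ) + k < d
    · rw [dif_pos h, nilpotentJordanBlock_mulVec]
      rfl
    · rw [dif_neg h, dif_neg (by omega)]

/-- The k-th power shifts coordinates by k, so its kernel consists of the vectors supported on the
indices below k. -/
theorem finrank_ker_nilpotentJordanBlock_pow (d k : ℕ) :
    Module.finrank ℂ (LinearMap.ker (nilpotentJordanBlock d ^ k).mulVecLin) = min d k := by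
  have hker : LinearMap.ker (nilpotentJordanBlock d ^ k).mulVecLin
      = ⨅ i ∈ {i : Fin d | ¬ (i : ℕ) < k},
        LinearMap.ker (LinearMap.proj i : (Fin d → ℂ) →ₗ[ℂ] ℂ) := by
    ext v
    simp only [LinearMap.mem_ker, mulVecLin_apply, Submodule.mem_iInf, Set.mem_ofPred_eq,
      LinearMap.proj_apply, funext_iff, nilpotentJordanBlock_pow_mulVec, Pi.zero_apply]
    constructor
    · intro h i hi
      -- For i ≥ k, row i - k of the k-th power reads off the coordinate v i.
      have := h ⟨i - k, by omega⟩
      simp only at this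
      rw [dif_pos (by omega)] at this
      rw [← this]
      congr 1
      ext
      simp only
      omega
    · intro h i
      split_ifs with h'
      · exact h _ (by simp)
      · rfl
  rw [hker]
  have hd : Disjoint {i : Fin d | (i : ℕ) < k} {i : Fin d | ¬ (i : ℕ) < k} := by
    rw [Set.disjoint_left]
    intro i hi h
    exact h hi
  rw [(LinearMap.iInfKerProjEquiv ℂ (fun _ : Fin d => ℂ) hd
    (fun i _ => Classical.em ((i : ℕ) < k))).finrank_eq, Module.finrank_fintype_fun_eq_card]
  exact (Fintype.card_subtype _).trans ((Fin.card_filter_val_lt).trans rfl)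

theorem blockTriangular_nilpotentJordanBlock (d : ℕ) (c : ℂ) :
    (c • (1 : Matrix (Fin d) (Fin d) ℂ) + nilpotentJordanBlock d).BlockTriangular id := by
  intro i j h
  have h : j < i := h
  have h1 : ¬ (i : ℕ) + 1 = j := by omega
  simp [nilpotentJordanBlock, h1, one_apply_ne h.ne']

theorem det_smul_one_add_nilpotentJordanBlock (d : ℕ) (c : ℂ) :
    (c • (1 : Matrix (Fin d) (Fin d) ℂ) + nilpotentJordanBlock d).det = c ^ d := by
  rw [det_of_isUpperTriangular (blockTriangular_nilpotentJordanBlock d c)]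
  simp [nilpotentJordanBlock]

theorem kerDim_smul_one_add_nilpotentJordanBlock (d : ℕ) (c μ : ℂ) (k : ℕ) :
    (c • (1 : Matrix (Fin d) (Fin d) ℂ) + nilpotentJordanBlock d).kerDim μ k
      = if c = μ then min d k else 0 := by
  split_ifs with h
  · rw [kerDim, h, add_sub_cancel_left, finrank_ker_nilpotentJordanBlock_pow]
  · apply kerDim_eq_zero_of_notMem_spectrum
    rw [← isUnit_sub_smul_one_iff, add_sub_right_comm, ← sub_smul, isUnit_iff_isUnit_det,
      det_smul_one_add_nilpotentJordanBlock, isUnit_iff_ne_zero]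
    exact pow_ne_zero _ (sub_ne_zero.2 h)

/-- The block diagonal matrix whose diagonal blocks are the Jordan blocks of dimension `e i` with
eigenvalue `ev i`. -/
def jordanMatrix {ι : Type*} [DecidableEq ι] (ev : ι → ℂ) (e : ι → ℕ) :
    Matrix (Σ i, Fin (e i)) (Σ i, Fin (e i)) ℂ :=
  blockDiagonal' fun i => ev i • (1 : Matrix (Fin (e i)) (Fin (e i)) ℂ) + nilpotentJordanBlock (e i)

section jordanMatrix

variable {ι κ : Type*} [Fintype ι] [DecidableEq ι] [Fintype κ] [DecidableEq κ]

theorem kerDim_jordanMatrix (ev : ι → ℂ) (e : ι → ℕ) (μ : ℂ) (k : ℕ) :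
    (jordanMatrix ev e).kerDim μ k = ∑ i, if ev i = μ then min (e i) k else 0 := by
  rw [jordanMatrix, kerDim_blockDiagonal']
  simp only [kerDim_smul_one_add_nilpotentJordanBlock]

theorem charpoly_jordanMatrix (ev : ι → ℂ) (e : ι → ℕ) :
    (jordanMatrix ev e).charpoly = ∏ i, (X - C (ev i)) ^ e i := by
  -- Any linear order on the blocks will do: the lexicographic order on the pairs then makes the
  -- matrix upper triangular.
  let : LinearOrder ι := LinearOrder.lift' _ (Fintype.equivFin ι).injective
  let E : (Σ i, Fin (e i)) ≃ Σₗ i, Fin (e i) := toLex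
  have ht : (reindex E E (jordanMatrix ev e)).IsUpperTriangular := by
    intro x y h
    obtain ⟨⟨i, x⟩, rfl⟩ := E.surjective x
    obtain ⟨⟨j, y⟩, rfl⟩ := E.surjective y
    rw [reindex_apply, submatrix_apply, E.symm_apply_apply, E.symm_apply_apply, jordanMatrix]
    rcases Sigma.Lex.lt_def.1 h with hlt | ⟨heq, hlt⟩
    · exact blockDiagonal'_apply_ne _ _ _ (ne_of_gt hlt)
    · change j = i at heq
      subst heq
      rw [blockDiagonal'_apply_eq]
      exact blockTriangular_nilpotentJordanBlock _ _ hlt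
  rw [← charpoly_reindex E, charpoly_of_isUpperTriangular _ ht, ← E.prod_comp, Fintype.prod_sigma]
  refine Finset.prod_congr rfl fun i _ => ?_
  simp [jordanMatrix, nilpotentJordanBlock]

theorem count_roots_charpoly_jordanMatrix (ev : ι → ℂ) (e : ι → ℕ) (μ : ℂ) :
    (jordanMatrix ev e).charpoly.roots.count μ = ∑ i, if ev i = μ then e i else 0 := by
  rw [charpoly_jordanMatrix, roots_prod _ _ (Finset.prod_ne_zero_iff.2 fun i _ =>
    pow_ne_zero _ (X_sub_C_ne_zero _)), Multiset.count_bind]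
  refine congrArg Multiset.sum (Multiset.map_congr rfl fun i _ => ?_)
  rw [roots_pow, roots_X_sub_C, Multiset.count_nsmul, Multiset.count_singleton]
  simp [eq_comm]

end jordanMatrix

/-! ### Recovering block sizes from truncated sums. -/

/-- Kernel dimensions see block sizes d only through the sums of min d k. First differences of these
sums count the blocks larger than k; differences of those counts give the blocks of size exactly k +
1. -/
theorem Multiset.sum_map_min_succ (s : Multiset ℕ) (k : ℕ) :
    (s.map fun d => min d (k + 1)).sum = (s.map fun d => min d k).sum + s.countP (k < ·) := by
  induction s using Multiset.induction with
  | empty => simp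
  | cons a s ih =>
    simp only [map_cons, sum_cons, countP_cons, ih]
    split_ifs <;> omega

theorem Multiset.count_succ_add_countP (s : Multiset ℕ) (k : ℕ) :
    s.count (k + 1) + s.countP (k + 1 < ·) = s.countP (k < ·) := by
  induction s using Multiset.induction with
  | empty => simp
  | cons a s ih =>
    simp only [count_cons, countP_cons, ← ih]
    split_ifs <;> omega

/-- A multiset of positive natural numbers is determined by its truncated sums. -/
theorem Multiset.eq_of_sum_map_min_eq {s t : Multiset ℕ} (hs : 0 ∉ s) (ht : 0 ∉ t)
    (h : ∀ k, (s.map fun d => min d k).sum = (t.map fun d => min d k).sum) : s = t := by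
  have hP : ∀ k, s.countP (k < ·) = t.countP (k < ·) := fun k => by
    have h1 := s.sum_map_min_succ k
    have h2 := t.sum_map_min_succ k
    have h3 := h k
    have h4 := h (k + 1)
    omega
  ext (_ | k)
  · rw [count_eq_zero_of_notMem hs, count_eq_zero_of_notMem ht]
  · have h1 := s.count_succ_add_countP k
    have h2 := t.count_succ_add_countP k
    have h3 := hP k
    have h4 := hP (k + 1)
    omega

/-- Equal multisets of values mean fibres of equal cardinality, and bijections between the fibres
glue. -/
theorem Fintype.exists_equiv_of_map_univ_eq {α β γ : Type*} [Fintype α] [Fintype β]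
    {f : α → γ} {g : β → γ}
    (h : (Finset.univ.val.map f : Multiset γ) = Finset.univ.val.map g) :
    ∃ σ : α ≃ β, ∀ a, g (σ a) = f a := by
  classical
  have hc : ∀ c, Nonempty ({a // f a = c} ≃ {b // g b = c}) := by
    intro c
    rw [← Fintype.card_eq, Fintype.card_subtype, Fintype.card_subtype]
    have := congrArg (Multiset.count c) h
    rw [Multiset.count_map, Multiset.count_map] at this
    simpa only [Finset.card_def, Finset.filter_val, eq_comm] using this
  exact ⟨Equiv.ofFiberEquiv fun c => (hc c).some, fun a => Equiv.ofFiberEquiv_map _ a⟩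

/-! ### Existence of a Jordan form via modules over ℂ[X]. -/

/-- Multiplication by `X` on `ℂ[X] ⧸ ((X - c) ^ d)` is given by a Jordan block. -/
theorem exists_linearEquiv_quotient_X_sub_C_pow (c : ℂ) (d : ℕ) {I : Ideal ℂ[X]}
    (hI : I = Ideal.span {(X - C c) ^ d}) :
    ∃ φ : (Fin d → ℂ) ≃ₗ[ℂ] ℂ[X] ⧸ I, ∀ v,
      φ ((c • (1 : Matrix (Fin d) (Fin d) ℂ) + nilpotentJordanBlock d) *ᵥ v) = (X : ℂ[X]) • φ v := by
  -- The powers of X - c are listed in descending order: multiplication by X - c then sends basis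
  -- vector j to j - 1, which puts the ones on the superdiagonal.
  let Φ : (Fin d → ℂ) →ₗ[ℂ] ℂ[X] :=
    Fintype.linearCombination ℂ fun j : Fin d => (X - C c) ^ (d - 1 - (j : ℕ))
  have hΦ : ∀ v, Φ v = ∑ j, v j • (X - C c) ^ (d - 1 - (j : ℕ)) := fun v => rfl
  let φ : (Fin d → ℂ) →ₗ[ℂ] ℂ[X] ⧸ I := (I.mkQ.restrictScalars ℂ).comp Φ
  have hφ : ∀ v, φ v = I.mkQ (Φ v) := fun v => rfl
  have hinj : Function.Injective φ := by
    rw [injective_iff_map_eq_zero]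
    intro v hv
    rw [hφ, Submodule.mkQ_apply, Submodule.Quotient.mk_eq_zero, hI,
      Ideal.mem_span_singleton] at hv
    -- The substitution X ↦ X + c turns divisibility by (X - c)^d into the vanishing of the
    -- coefficients below d.
    have h2 := map_dvd (compRingHom (X + C c)) hv
    simp only [hΦ, map_sum, map_pow, coe_compRingHom_apply, smul_eq_C_mul, map_mul, sub_comp,
      X_comp, C_comp, add_sub_cancel_right, X_pow_dvd_iff, finsetSum_coeff, coeff_C_mul_X_pow] at h2
    ext i
    have h3 := h2 (d - 1 - i) (by omega)
    rw [Finset.sum_eq_single i] at h3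
    · simpa using h3
    · intro j _ hj
      exact if_neg fun h => hj (Fin.ext (by omega))
    · simp
  have hmon : ((X - C c) ^ d).Monic := (monic_X_sub_C c).pow d
  have hfin : Module.finrank ℂ (Fin d → ℂ) = Module.finrank ℂ (ℂ[X] ⧸ I) := by
    rw [hI, finrank_quotient_span_eq_natDegree, natDegree_pow, natDegree_X_sub_C]
    simp
  have : Module.Finite ℂ (ℂ[X] ⧸ I) := by
    rw [hI]
    exact hmon.finite_quotient
  refine ⟨LinearEquiv.ofInjectiveOfFinrankEq φ hinj hfin, fun v => ?_⟩
  change φ _ = (X : ℂ[X]) • φ v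
  rw [hφ, hφ, ← map_smul, ← sub_eq_zero, ← map_sub, Submodule.mkQ_apply,
    Submodule.Quotient.mk_eq_zero, hI, Ideal.mem_span_singleton]
  rw [add_mulVec, smul_mulVec, one_mulVec, map_add, map_smul]
  have hX : (X : ℂ[X]) • Φ v = c • Φ v + (X - C c) * Φ v := by
    rw [smul_eq_mul, smul_eq_C_mul]
    ring
  rw [hX, add_sub_add_left_eq_sub]
  cases d with
  | zero => simp [hΦ]
  | succ d =>
    have h1 : Φ (nilpotentJordanBlock (d + 1) *ᵥ v)
        = ∑ j : Fin d, v j.succ • (X - C c) ^ (d - (j : ℕ)) := by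
      rw [hΦ, Fin.sum_univ_castSucc]
      simp [nilpotentJordanBlock_mulVec, Fin.succ]
    have h2 : (X - C c) * Φ v = v 0 • (X - C c) ^ (d + 1)
        + ∑ j : Fin d, v j.succ • (X - C c) ^ (d - (j : ℕ)) := by
      rw [hΦ, Fin.sum_univ_succ, mul_add, Finset.mul_sum]
      congr 1
      · simp [pow_succ']
      · refine Finset.sum_congr rfl fun j _ => ?_
        rw [mul_smul_comm, ← pow_succ']
        congr 2
        simp only [Fin.val_succ]
        omega
    -- The two sides differ only by a multiple of (X - c)^(d + 1), which is zero in the quotient.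
    rw [h1, h2, sub_add_cancel_right, dvd_neg, smul_eq_C_mul]
    exact dvd_mul_left _ _

theorem exists_span_singleton_pow_eq {p : ℂ[X]} (hp : Irreducible p) (d : ℕ) :
    ∃ c : ℂ, Submodule.span ℂ[X] {p ^ d} = Ideal.span {(X - C c) ^ d} := by
  obtain ⟨c, hc⟩ := IsAlgClosed.exists_root p (degree_pos_of_irreducible hp).ne'
  refine ⟨c, Ideal.span_singleton_eq_span_singleton.2 (Associated.pow_pow ?_)⟩
  exact ((irreducible_X_sub_C c).associated_of_dvd hp (dvd_iff_isRoot.2 hc)).symm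

/-- Let X act on ℂ^n as A. The structure theorem for torsion modules over ℂ[X] gives cyclic
summands, and over ℂ each irreducible is associated to some X - c. -/
theorem Matrix.exists_intertwined_jordanMatrix {n : Type*} [Fintype n] [DecidableEq n]
    (A : Matrix n n ℂ) :
    ∃ (ι : Type) (_ : Fintype ι) (_ : DecidableEq ι) (ev : ι → ℂ) (e : ι → ℕ),
      Intertwined A (jordanMatrix ev e) := by
  classical
  have hM := Module.AEval.isTorsion_of_finiteDimensional ℂ (n → ℂ) (toLin' A)
  obtain ⟨ι, _, p, hp, e, ⟨ψ⟩⟩ := Module.equiv_directSum_of_isTorsion hM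
  choose ev hev using fun i => exists_span_singleton_pow_eq (hp i) (e i)
  choose φ hφ using fun i => exists_linearEquiv_quotient_X_sub_C_pow (ev i) (e i) (hev i)
  refine ⟨ι, inferInstance, inferInstance, ev, e, ?_⟩
  let α : ((Σ i, Fin (e i)) → ℂ) ≃ₗ[ℂ] ∀ i, Fin (e i) → ℂ :=
    LinearEquiv.piCurry ℂ fun _ _ => ℂ
  let β : (∀ i, Fin (e i) → ℂ) ≃ₗ[ℂ] ∀ i, ℂ[X] ⧸ Submodule.span ℂ[X] {p i ^ e i} :=
    LinearEquiv.piCongrRight φ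
  let γ := DirectSum.linearEquivFunOnFintype ℂ[X] ι
    fun i => ℂ[X] ⧸ Submodule.span ℂ[X] {p i ^ e i}
  let δ := ((γ.symm.trans ψ.symm).restrictScalars ℂ)
  refine ⟨((α.trans β).trans δ).trans (Module.AEval'.of (toLin' A)).symm, fun v => ?_⟩
  have h1 : β (α (jordanMatrix ev e *ᵥ v)) = (X : ℂ[X]) • β (α v) := by
    funext i
    have h2 : α (jordanMatrix ev e *ᵥ v) i
        = (ev i • (1 : Matrix (Fin (e i)) (Fin (e i)) ℂ) + nilpotentJordanBlock (e i)) *ᵥ α v i :=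
      funext fun j => blockDiagonal'_mulVec _ v i j
    change φ i (α (jordanMatrix ev e *ᵥ v) i) = (X : ℂ[X]) • φ i (α v i)
    rw [h2, hφ]
  have h2 : δ ((X : ℂ[X]) • β (α v)) = (X : ℂ[X]) • δ (β (α v)) :=
    (γ.symm.trans ψ.symm).map_smul _ _
  change (Module.AEval'.of (toLin' A)).symm (δ (β (α _))) = A *ᵥ
    (Module.AEval'.of (toLin' A)).symm (δ (β (α v)))
  rw [h1, h2, Module.AEval'.of_symm_X_smul, toLin'_apply]

/-! ### Kernel dimensions as a complete similarity invariant. -/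

theorem Multiset.sum_map_ite_eq_sum_map_filter {ι : Type*} (s : Multiset ι) (P : ι → Prop) [DecidablePred P]
    (g : ι → ℕ) : (s.map fun i => if P i then g i else 0).sum = ((s.filter P).map g).sum := by
  induction s using Multiset.induction with
  | empty => simp
  | cons a s ih =>
    by_cases h : P a <;> simp [h, ih]

section

variable {ι κ : Type*} [Fintype ι] [DecidableEq ι] [Fintype κ] [DecidableEq κ]

/-- Serves both to permute blocks and to discard the empty blocks that the structure theorem may
produce. -/
theorem intertwined_jordanMatrix_comp (ev : ι → ℂ) (e : ι → ℕ) {f : κ → ι}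
    (hf : Function.Injective f) (he : ∀ i, i ∉ Set.range f → e i = 0) :
    Intertwined (jordanMatrix ev e) (jordanMatrix (fun k => ev (f k)) fun k => e (f k)) := by
  let E : (Σ k, Fin (e (f k))) ≃ Σ i, Fin (e i) := Equiv.ofBijective (fun x => ⟨f x.1, x.2⟩) (by
    constructor
    · rintro ⟨k, x⟩ ⟨l, y⟩ h
      obtain rfl : k = l := hf (congrArg Sigma.fst h)
      simpa using h
    · rintro ⟨i, x⟩
      by_cases hi : i ∈ Set.range f
      · obtain ⟨k, rfl⟩ := hi
        exact ⟨⟨k, x⟩, rfl⟩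
      · exact absurd x.2 (by simp [he i hi]))
  have hE : jordanMatrix ev e
      = reindex E E (jordanMatrix (fun k => ev (f k)) fun k => e (f k)) := by
    ext x y
    obtain ⟨⟨k, x⟩, rfl⟩ := E.surjective x
    obtain ⟨⟨l, y⟩, rfl⟩ := E.surjective y
    rw [reindex_apply, submatrix_apply, E.symm_apply_apply, E.symm_apply_apply]
    change jordanMatrix ev e ⟨f k, x⟩ ⟨f l, y⟩ = _
    simp only [jordanMatrix]
    by_cases h : k = l
    · subst h
      rw [blockDiagonal'_apply_eq, blockDiagonal'_apply_eq]
    · rw [blockDiagonal'_apply_ne _ _ _ h, blockDiagonal'_apply_ne _ _ _ (hf.ne h)]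
  rw [hE]
  exact intertwined_reindex E _

theorem intertwined_jordanMatrix_of_pos {ev : ι → ℂ} {e : ι → ℕ} {ev' : κ → ℂ} {e' : κ → ℕ}
    (he : ∀ i, 0 < e i) (he' : ∀ i, 0 < e' i)
    (h : ∀ μ k, (jordanMatrix ev e).kerDim μ k = (jordanMatrix ev' e').kerDim μ k) :
    Intertwined (jordanMatrix ev e) (jordanMatrix ev' e') := by
  have hmap : (Finset.univ.val.map fun i => (ev i, e i))
      = Finset.univ.val.map fun i => (ev' i, e' i) := by
    -- For each μ the kernel dimensions recover the multiset of block sizes; positivity matters,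
    -- since empty blocks are invisible to them.
    have hμ : ∀ μ, ((Finset.univ.val.filter fun i => ev i = μ).map e)
        = (Finset.univ.val.filter fun i => ev' i = μ).map e' := by
      intro μ
      refine Multiset.eq_of_sum_map_min_eq ?_ ?_ fun k => ?_
      · simpa using fun i _ => (he i).ne'
      · simpa using fun i _ => (he' i).ne'
      · have := h μ k
        rw [kerDim_jordanMatrix, kerDim_jordanMatrix, Finset.sum, Finset.sum,
          Multiset.sum_map_ite_eq_sum_map_filter, Multiset.sum_map_ite_eq_sum_map_filter] at this
        simpa using this
    ext ⟨μ, d⟩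
    have := congrArg (Multiset.count d) (hμ μ)
    rw [Multiset.count_map, Multiset.count_map, Multiset.filter_filter,
      Multiset.filter_filter] at this
    rw [Multiset.count_map, Multiset.count_map]
    simpa only [Prod.mk.injEq, and_comm, eq_comm] using this
  obtain ⟨σ, hσ⟩ := Fintype.exists_equiv_of_map_univ_eq hmap
  obtain rfl : (fun i => ev' (σ i)) = ev := funext fun i => congrArg Prod.fst (hσ i)
  obtain rfl : (fun i => e' (σ i)) = e := funext fun i => congrArg Prod.snd (hσ i)
  exact (intertwined_jordanMatrix_comp ev' e' σ.injective
    fun i hi => absurd (σ.surjective i) hi).symm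

theorem Matrix.exists_intertwined_jordanMatrix_pos (A : Matrix ι ι ℂ) :
    ∃ (κ : Type) (_ : Fintype κ) (_ : DecidableEq κ) (ev : κ → ℂ) (e : κ → ℕ),
      (∀ i, 0 < e i) ∧ Intertwined A (jordanMatrix ev e) := by
  obtain ⟨κ, _, _, ev, e, h⟩ := exists_intertwined_jordanMatrix A
  exact ⟨{i // 0 < e i}, inferInstance, inferInstance, fun i => ev i, fun i => e i, fun i => i.2,
    h.trans (intertwined_jordanMatrix_comp ev e Subtype.val_injective fun i hi => by simpa using hi)⟩

/-- Complex matrices are similar as soon as their generalized eigenspaces of all orders have the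
same dimensions. -/
theorem Matrix.intertwined_iff_kerDim {A : Matrix ι ι ℂ} {B : Matrix κ κ ℂ} :
    Intertwined A B ↔ ∀ μ k, A.kerDim μ k = B.kerDim μ k := by
  refine ⟨fun h => h.kerDim_eq, fun h => ?_⟩
  obtain ⟨_, _, _, ev, e, he, hA⟩ := exists_intertwined_jordanMatrix_pos A
  obtain ⟨_, _, _, ev', e', he', hB⟩ := exists_intertwined_jordanMatrix_pos B
  refine (hA.trans (intertwined_jordanMatrix_of_pos he he' fun μ k => ?_)).trans hB.symm
  rw [← hA.kerDim_eq, ← hB.kerDim_eq, h]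

theorem Matrix.Intertwined.charpoly_eq {A : Matrix ι ι ℂ} {B : Matrix κ κ ℂ}
    (h : Intertwined A B) : A.charpoly = B.charpoly := by
  let e := Fintype.equivOfCardEq h.card_eq
  obtain ⟨P, hP⟩ := h.exists_conj e
  rw [hP, coe_units_inv, charpoly_units_conj, charpoly_reindex]

end

/-! ### Jordan data and Jordan decompositions. -/

namespace JordanData

theorem intertwined_toMatrix (D : JordanData) :
    Intertwined D.toMatrix (jordanMatrix (fun x : Σ k, Fin (D.blocks k).length => D.ev x.1)
      fun x => (D.blocks x.1).get x.2) := by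
  let E := Equiv.sigmaAssoc fun (k : Fin D.m) (b : Fin (D.blocks k).length) =>
    Fin ((D.blocks k).get b)
  have hE : D.toMatrix = reindex E E (jordanMatrix
      (fun x : Σ k, Fin (D.blocks k).length => D.ev x.1) fun x => (D.blocks x.1).get x.2) := by
    ext ⟨k, b, x⟩ ⟨l, c, y⟩
    change D.toMatrix ⟨k, b, x⟩ ⟨l, c, y⟩ = jordanMatrix
      (fun x : Σ k, Fin (D.blocks k).length => D.ev x.1) (fun x => (D.blocks x.1).get x.2)
      ⟨⟨k, b⟩, x⟩ ⟨⟨l, c⟩, y⟩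
    simp only [toMatrix, jordanMatrix, nilpotentPart, nilpotentJordanMatrix]
    by_cases h : k = l
    · subst h
      rw [blockDiagonal'_apply_eq]
      by_cases h : b = c
      · subst h
        rw [blockDiagonal'_apply_eq, Matrix.add_apply, Matrix.add_apply, blockDiagonal'_apply_eq]
        congr 1
        simp [one_apply]
      · rw [blockDiagonal'_apply_ne _ _ _ (by simpa using h), Matrix.add_apply,
          blockDiagonal'_apply_ne _ _ _ h, Matrix.smul_apply, one_apply_ne (by simp [h])]
        simp
    · rw [blockDiagonal'_apply_ne _ _ _ h, blockDiagonal'_apply_ne _ _ _ (by simp [h])]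
  rw [hE]
  exact intertwined_reindex E _

theorem kerDim_toMatrix (D : JordanData) (μ : ℂ) (t : ℕ) :
    D.toMatrix.kerDim μ t
      = ∑ k, if D.ev k = μ then ((D.blocks k).map fun d => min d t).sum else 0 := by
  rw [D.intertwined_toMatrix.kerDim_eq, kerDim_jordanMatrix, Fintype.sum_sigma]
  refine Finset.sum_congr rfl fun k _ => ?_
  split_ifs with h
  · rw [← List.sum_ofFn]
    congr 1
    conv_rhs => rw [← List.ofFn_get (D.blocks k), List.map_ofFn]
    rfl
  · simp

theorem kerDim_toMatrix_ev (D : JordanData) (k : Fin D.m) (t : ℕ) :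
    D.toMatrix.kerDim (D.ev k) t = ((D.blocks k).map fun d => min d t).sum := by
  simp [kerDim_toMatrix, D.ev_injective.eq_iff]

theorem count_roots_charpoly_toMatrix (D : JordanData) (k : Fin D.m) :
    D.toMatrix.charpoly.roots.count (D.ev k) = D.dim k := by
  rw [D.intertwined_toMatrix.charpoly_eq, count_roots_charpoly_jordanMatrix, Fintype.sum_sigma,
    Finset.sum_eq_single k]
  · simp only [if_true]
    rw [← List.sum_ofFn, List.ofFn_get]
    rfl
  · intro l _ hl
    simp [D.ev_injective.ne hl]
  · simp

end JordanData

namespace JordanDecomposition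

variable {n : ℕ} {A : Matrix (Fin n) (Fin n) ℂ}

theorem intertwined (J : JordanDecomposition A) : Intertwined A J.toMatrix := by
  have h := (intertwined_conj J.P (reindex J.e J.e J.toMatrix)).trans (intertwined_reindex J.e _)
  rwa [← J.eq_conj] at h

theorem kerDim_ev (J : JordanDecomposition A) (k : Fin J.m) (t : ℕ) :
    A.kerDim (J.ev k) t = ((J.blocks k).map fun d => min d t).sum := by
  rw [J.intertwined.kerDim_eq, J.kerDim_toMatrix_ev]

theorem count_ev (J : JordanDecomposition A) (k : Fin J.m) :
    (eigenMultiset A).count (J.ev k) = J.dim k := by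
  rw [eigenMultiset, J.intertwined.charpoly_eq, J.count_roots_charpoly_toMatrix]

theorem perm_blocks_iff (J : JordanDecomposition A) (k l : Fin J.m) :
    (J.blocks k).Perm (J.blocks l) ↔ ∀ t, A.kerDim (J.ev k) t = A.kerDim (J.ev l) t := by
  simp only [kerDim_ev]
  constructor
  · intro h t
    exact (h.map _).sum_eq
  · intro h
    rw [← Multiset.coe_eq_coe]
    refine Multiset.eq_of_sum_map_min_eq ?_ ?_ fun t => ?_
    · exact fun h => (J.blocks_pos k 0 h).false
    · exact fun h => (J.blocks_pos l 0 h).false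
    · simpa using h t

theorem exists_ev_eq (J : JordanDecomposition A) {x : ℂ} (hx : x ∈ spectrum ℂ A) :
    ∃ k, J.ev k = x := by
  by_contra! h
  refine kerDim_one_eq_zero_iff.1 ?_ hx
  rw [J.intertwined.kerDim_eq, JordanData.kerDim_toMatrix]
  simp [h]

end JordanDecomposition

/-- Every complex square matrix has a Jordan normal form. -/
theorem nonempty_jordanDecomposition {n : ℕ} (A : Matrix (Fin n) (Fin n) ℂ) :
    Nonempty (JordanDecomposition A) := by
  classical
  obtain ⟨ι, _, _, ev, e, he, hA⟩ := exists_intertwined_jordanMatrix_pos A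
  -- Blocks with the same eigenvalue are collected into one part, which makes the eigenvalues of the
  -- parts distinct.
  let S := Finset.univ.image ev
  let E : Fin S.card ≃ S := S.equivFin.symm
  let D : JordanData :=
    { m := S.card
      ev := fun k => (E k : ℂ)
      ev_injective := Subtype.val_injective.comp E.injective
      blocks := fun k => (Finset.univ.filter fun i => ev i = E k).toList.map e
      blocks_ne_nil := fun k => by
        obtain ⟨i, -, hi⟩ := Finset.mem_image.1 (E k).2
        rw [Ne, List.map_eq_nil_iff, Finset.toList_eq_nil]
        exact Finset.ne_empty_of_mem (Finset.mem_filter.2 ⟨Finset.mem_univ i, hi⟩)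
      blocks_pos := fun k d hd => by
        obtain ⟨i, -, rfl⟩ := List.mem_map.1 hd
        exact he i }
  -- Comparing kernel dimensions replaces an explicit permutation of the blocks.
  have hD : Intertwined A D.toMatrix := by
    refine hA.trans (intertwined_iff_kerDim.2 fun μ t => ?_)
    rw [kerDim_jordanMatrix, D.kerDim_toMatrix]
    have h1 : ∀ k, ((D.blocks k).map fun d => min d t).sum
        = ∑ i ∈ Finset.univ.filter (fun i => ev i = E k), min (e i) t := by
      intro k
      rw [← Finset.sum_map_toList]
      simp [D, Function.comp_def]
    simp only [h1]
    change _ = ∑ k, if (E k : ℂ) = μ then _ else 0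
    rw [E.sum_comp fun s : S => if (s : ℂ) = μ then
      ∑ i ∈ Finset.univ.filter (fun i => ev i = s), min (e i) t else 0,
      Finset.sum_coe_sort S fun s => if s = μ then
      ∑ i ∈ Finset.univ.filter (fun i => ev i = s), min (e i) t else 0, Finset.sum_ite_eq',
      Finset.sum_filter]
    split_ifs with hμ
    · rfl
    · refine Finset.sum_eq_zero fun i _ => if_neg ?_
      rintro rfl
      exact hμ (Finset.mem_image_of_mem ev (Finset.mem_univ i))
  have hcard : Fintype.card D.Idx = Fintype.card (Fin n) := hD.card_eq
  obtain ⟨P, hP⟩ := hD.exists_conj (Fintype.equivOfCardEq hcard)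
  exact ⟨{ D with e := Fintype.equivOfCardEq hcard, P := P, eq_conj := hP }⟩

/-! ### Power maps on the eigenvalues and their orbits. -/

/-- A matching of the `p`-th powers with the `q`-th powers of the elements of `U`. -/
theorem Multiset.exists_perm_zpow_eq {p q : ℤ} {U : Multiset ℂ}
    (hU : U.map (fun x => x ^ p) = U.map fun x => x ^ q) :
    ∃ (m : ℕ) (f : Fin m → ℂ) (σ : Equiv.Perm (Fin m)),
      (∀ x, x ∈ U ↔ ∃ i, f i = x) ∧ ∀ i, f i ^ q = f (σ i) ^ p := by
  obtain ⟨L, rfl⟩ := Quot.exists_rep U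
  have hL : Finset.univ.val.map L.get = (L : Multiset ℂ) := by
    rw [Fin.univ_val_map, List.ofFn_get]
  obtain ⟨σ, hσ⟩ := Fintype.exists_equiv_of_map_univ_eq
    (f := fun i => L.get i ^ q) (g := fun i => L.get i ^ p) (by
      have h1 := Multiset.map_map (fun x : ℂ => x ^ q) L.get Finset.univ.val
      have h2 := Multiset.map_map (fun x : ℂ => x ^ p) L.get Finset.univ.val
      rw [hL] at h1 h2
      exact h1.symm.trans (hU.symm.trans h2))
  exact ⟨L.length, L.get, σ, fun x => List.mem_iff_get, fun i => (hσ i).symm⟩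

theorem exists_isOrbitSeq {p q : ℤ} {U : Multiset ℂ}
    (hU : U.map (fun x => x ^ p) = U.map fun x => x ^ q) {x : ℂ} (hx : x ∈ U) :
    ∃ s, IsOrbitSeq p q U s ∧ s 1 = x := by
  obtain ⟨m, f, σ, hf, hσ⟩ := Multiset.exists_perm_zpow_eq hU
  obtain ⟨i, rfl⟩ := (hf x).1 hx
  -- The sequence follows the σ-orbit; the shift k - 1 puts x at index 1.
  refine ⟨fun k => f ((σ ^ (k - 1)) i), fun k => ⟨(hf _).2 ⟨_, rfl⟩, ?_⟩, by simp⟩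
  rw [hσ, ← Equiv.Perm.mul_apply, ← _root_.zpow_one_add, show 1 + (k - 1) = k + 1 - 1 by ring]

/-- With N the order of σ, every ratio x / y of elements of U is killed by q^N - p^N, which is
coprime to p. If x^p = y^p, the ratio is also killed by p, hence equals 1. -/
theorem injOn_zpow_of_map_zpow_eq {p q : ℤ} (hcop : IsCoprime p q) {U : Multiset ℂ}
    (h0 : 0 ∉ U) (hU : U.map (fun x => x ^ p) = U.map fun x => x ^ q) :
    Set.InjOn (fun x : ℂ => x ^ p) {x | x ∈ U} := by
  obtain ⟨m, f, σ, hf, hσ⟩ := Multiset.exists_perm_zpow_eq hU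
  have hiter : ∀ (L : ℕ) i, f i ^ (q ^ L) = f ((σ ^ L) i) ^ (p ^ L) := by
    intro L
    induction L with
    | zero => simp
    | succ L ih =>
      intro i
      rw [pow_succ, _root_.zpow_mul, ih, ← _root_.zpow_mul, mul_comm, _root_.zpow_mul, hσ, ← _root_.zpow_mul, pow_succ' p,
        pow_succ' σ, Equiv.Perm.mul_apply]
  have hcyc : ∀ x ∈ U, x ^ (q ^ orderOf σ - p ^ orderOf σ) = 1 := by
    intro x hx
    have hx0 : x ≠ 0 := fun h => h0 (h ▸ hx)
    obtain ⟨i, rfl⟩ := (hf x).1 hx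
    have := hiter (orderOf σ) i
    rw [pow_orderOf_eq_one, Equiv.Perm.one_apply] at this
    rw [_root_.zpow_sub₀ hx0, this, div_self (_root_.zpow_ne_zero _ hx0)]
  intro x hx y hy hxy
  have hx0 : x ≠ 0 := fun h => h0 (h ▸ hx)
  have hy0 : y ≠ 0 := fun h => h0 (h ▸ hy)
  have h1 : (x / y) ^ p = 1 := by
    rw [_root_.div_zpow]
    exact (div_eq_one_iff_eq (_root_.zpow_ne_zero _ hy0)).2 hxy
  have h2 : (x / y) ^ (q ^ orderOf σ - p ^ orderOf σ) = 1 := by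
    rw [_root_.div_zpow, hcyc x hx, hcyc y hy, div_one]
  have hc : IsCoprime p (q ^ orderOf σ - p ^ orderOf σ) := by
    obtain ⟨c, hc⟩ : p ∣ p ^ orderOf σ := dvd_pow_self p (orderOf_pos σ).ne'
    rw [hc, sub_eq_add_neg, ← mul_neg]
    exact (IsCoprime.add_mul_left_right_iff).2 hcop.pow_right
  obtain ⟨a, b, hab⟩ := hc
  have h3 : x / y = 1 := by
    rw [← _root_.zpow_one (x / y), ← hab, _root_.zpow_add₀ (div_ne_zero hx0 hy0), mul_comm a, mul_comm b,
      _root_.zpow_mul, _root_.zpow_mul, h1, h2, _root_.one_zpow, _root_.one_zpow, one_mul]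
  exact (div_eq_one_iff_eq hy0).1 h3

/-- By injectivity, the multiplicity of y in U is that of y^p in U^p, and the multiplicity of x is
that of x^q in U^q; these coincide. -/
theorem count_eq_of_zpow_eq {p q : ℤ} (hcop : IsCoprime p q) {U : Multiset ℂ} (h0 : 0 ∉ U)
    (hU : U.map (fun x => x ^ p) = U.map fun x => x ^ q) {x y : ℂ} (hx : x ∈ U) (hy : y ∈ U)
    (hxy : x ^ q = y ^ p) : U.count y = U.count x := by
  have hp := injOn_zpow_of_map_zpow_eq hcop h0 hU
  have hq := injOn_zpow_of_map_zpow_eq hcop.symm h0 hU.symm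
  rw [← Multiset.count_map_eq_count _ U hp _ hy, ← Multiset.count_map_eq_count _ U hq _ hx, hU, hxy]

/-- A function that is constant along the steps of orbit sequences is constant on orbits. -/
theorem eq_of_mem_powerOrbit {p q : ℤ} {U : Multiset ℂ} {α : Type*} {g : ℂ → α}
    (hg : ∀ x ∈ U, ∀ y ∈ U, x ^ q = y ^ p → g y = g x) {x y : ℂ}
    (hy : y ∈ powerOrbit p q U x) : g y = g x := by
  obtain ⟨s, hs, rfl, k, rfl⟩ := hy
  have hstep : ∀ i, g (s (i + 1)) = g (s i) := fun i =>
    hg _ (hs i).1 _ (hs (i + 1)).1 (hs i).2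
  induction k using Int.induction_on with
  | zero => simp
  | succ k ih => rw [hstep, ih]
  | pred k ih =>
    rw [← ih, ← hstep]
    congr 2
    ring

/-! ### Kernel dimensions of integer powers of a matrix. -/

namespace Matrix

variable {n : Type*} [Fintype n] [DecidableEq n]

theorem kerDim_inv {B : Matrix n n ℂ} (hB : IsUnit B) {μ : ℂ} (hμ : μ ≠ 0) (k : ℕ) :
    B⁻¹.kerDim μ⁻¹ k = B.kerDim μ k := by
  have hdet := (isUnit_iff_isUnit_det B).1 hB
  refine kerDim_eq_of_sub_eq_mul (g := -μ⁻¹ • B⁻¹) ?_ ?_ ?_ k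
  · have hB' : IsUnit B⁻¹ := (isUnit_nonsing_inv_iff).2 hB
    exact hB'.smul (Units.mk0 (-μ⁻¹) (neg_ne_zero.2 (inv_ne_zero hμ)))
  · refine Commute.smul_right ?_ _
    rw [Commute, SemiconjBy, mul_nonsing_inv B hdet, nonsing_inv_mul B hdet]
  · rw [mul_smul_comm, sub_mul, mul_nonsing_inv B hdet, smul_mul_assoc, one_mul, smul_sub,
      smul_smul, neg_mul, inv_mul_cancel₀ hμ]
    simp only [neg_smul, one_smul]
    abel

/-- Write A^m - μ^m = (A - μ) g(A). A root ν of g in the spectrum satisfies ν^m = μ^m, so ν = μ; but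
g(μ) = m μ^(m-1) ≠ 0. Hence g(A) is invertible. -/
theorem kerDim_pow {A : Matrix n n ℂ} {m : ℕ} (hm : m ≠ 0) {μ : ℂ} (hμ : μ ≠ 0)
    (hinj : ∀ ν ∈ spectrum ℂ A, ν ^ m = μ ^ m → ν = μ) (k : ℕ) :
    (A ^ m).kerDim (μ ^ m) k = A.kerDim μ k := by
  let g : ℂ[X] := ∑ i ∈ Finset.range m, X ^ i * C μ ^ (m - 1 - i)
  have hg : (X - C μ) * g = X ^ m - C μ ^ m := (Commute.all _ _).mul_geom_sum₂ m
  refine kerDim_eq_of_sub_eq_mul (g := aeval A g) ?_ ?_ ?_ k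
  · rcases isEmpty_or_nonempty n with h | h
    · exact isUnit_of_subsingleton _
    · rw [← spectrum.zero_notMem_iff ℂ, spectrum.map_polynomial_aeval_of_nonempty A g
        (spectrum.nonempty_of_isAlgClosed_of_finiteDimensional ℂ A)]
      rintro ⟨ν, hν, h0⟩
      simp only at h0
      have h1 := congrArg (eval ν) hg
      rw [eval_mul, h0, mul_zero] at h1
      simp only [eval_sub, eval_pow, eval_X, eval_C] at h1
      obtain rfl := hinj ν hν (sub_eq_zero.1 h1.symm)
      have h2 : eval ν g = m * ν ^ (m - 1) := by
        simp only [g, eval_finsetSum, eval_mul, eval_pow, eval_X, eval_C]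
        exact geom_sum₂_self ν m
      rw [h2] at h0
      exact mul_ne_zero (Nat.cast_ne_zero.2 hm) (pow_ne_zero _ hμ) h0
  · conv_lhs => rw [← aeval_X (R := ℂ) A]
    exact (Commute.all X g).map (aeval A)
  · have := congrArg (aeval A) hg
    simp only [map_mul, map_sub, aeval_X, aeval_C, map_pow] at this
    rw [← Algebra.algebraMap_eq_smul_one, ← Algebra.algebraMap_eq_smul_one, this, map_pow]

theorem kerDim_zpow {A : Matrix n n ℂ} (hA : IsUnit A) {p : ℤ} (hp : p ≠ 0) {μ : ℂ} (hμ : μ ≠ 0)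
    (hinj : ∀ ν ∈ spectrum ℂ A, ν ^ p = μ ^ p → ν = μ) (k : ℕ) :
    (A ^ p).kerDim (μ ^ p) k = A.kerDim μ k := by
  obtain ⟨m, rfl | rfl⟩ := p.eq_nat_or_neg
  · simp only [zpow_natCast] at hinj ⊢
    exact kerDim_pow (by simpa using hp) hμ hinj k
  · rw [zpow_neg ((isUnit_iff_isUnit_det A).1 hA), _root_.zpow_neg, zpow_natCast,
      _root_.zpow_natCast, kerDim_inv (hA.pow m) (pow_ne_zero m hμ)]
    simp only [_root_.zpow_neg, _root_.zpow_natCast] at hinj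
    exact kerDim_pow (by simpa using hp) hμ (fun ν hν h => hinj ν hν (congrArg _ h)) k

theorem exists_zpow_eq_of_mem_spectrum_zpow {A : Matrix n n ℂ} (hA : IsUnit A) {p : ℤ}
    (hp : p ≠ 0) {μ : ℂ} (hμ : μ ∈ spectrum ℂ (A ^ p)) : ∃ ν ∈ spectrum ℂ A, ν ^ p = μ := by
  have hpow : ∀ {m : ℕ} {ν : ℂ}, m ≠ 0 → ν ∈ spectrum ℂ (A ^ m) → ∃ x ∈ spectrum ℂ A, x ^ m = ν := by
    intro m ν hm hν
    rw [spectrum.map_pow_of_pos A (Nat.pos_of_ne_zero hm)] at hν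
    exact hν
  obtain ⟨m, rfl | rfl⟩ := p.eq_nat_or_neg
  · simp only [zpow_natCast, _root_.zpow_natCast] at hμ ⊢
    exact hpow (by simpa using hp) hμ
  · rw [zpow_neg ((isUnit_iff_isUnit_det A).1 hA), zpow_natCast] at hμ
    have hμ0 : μ ≠ 0 := by
      rintro rfl
      exact spectrum.zero_notMem ℂ ((isUnit_nonsing_inv_iff).2 (hA.pow m)) hμ
    have h1 : μ⁻¹ ∈ spectrum ℂ (A ^ m) := by
      by_contra h
      have h2 := kerDim_one_eq_zero_iff.2 h
      rw [← kerDim_inv (hA.pow m) (inv_ne_zero hμ0), inv_inv] at h2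
      exact kerDim_one_eq_zero_iff.1 h2 hμ
    obtain ⟨x, hx, h⟩ := hpow (by simpa using hp) h1
    exact ⟨x, hx, by rw [_root_.zpow_neg, _root_.zpow_natCast, h, inv_inv]⟩

end Matrix

/-! ### The invertible case. -/

section

variable {n : ℕ} {A : Matrix (Fin n) (Fin n) ℂ}

theorem mem_eigenMultiset_iff {x : ℂ} : x ∈ eigenMultiset A ↔ x ∈ spectrum ℂ A := by
  rw [eigenMultiset, mem_roots A.charpoly_monic.ne_zero, mem_spectrum_iff_isRoot_charpoly]

theorem zero_notMem_eigenMultiset (h : IsUnit A) : 0 ∉ eigenMultiset A := by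
  rw [mem_eigenMultiset_iff]
  exact spectrum.zero_notMem ℂ h

variable {p q : ℤ}

/-- The dimensions of the generalized eigenspaces agree for eigenvalues `x`, `y` of `A` with
`x ^ q = y ^ p`. -/
def KerDimCompatible (A : Matrix (Fin n) (Fin n) ℂ) (p q : ℤ) : Prop :=
  ∀ x ∈ eigenMultiset A, ∀ y ∈ eigenMultiset A, x ^ q = y ^ p → A.kerDim y = A.kerDim x

theorem isConj_zpow_iff_kerDimCompatible (hcop : IsCoprime p q) (hp : p ≠ 0) (hq : q ≠ 0)
    (hA : (eigenMultiset A).map (fun x => x ^ p) = (eigenMultiset A).map (fun x => x ^ q))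
    (hu : IsUnit A) : IsConj (A ^ p) (A ^ q) ↔ KerDimCompatible A p q := by
  have h0 := zero_notMem_eigenMultiset hu
  have hpk : ∀ x ∈ eigenMultiset A, ∀ k, (A ^ p).kerDim (x ^ p) k = A.kerDim x k :=
    fun x hx k => kerDim_zpow hu hp (ne_of_mem_of_not_mem hx h0) (fun ν hν h =>
      injOn_zpow_of_map_zpow_eq hcop h0 hA (mem_eigenMultiset_iff.2 hν) hx h) k
  have hqk : ∀ x ∈ eigenMultiset A, ∀ k, (A ^ q).kerDim (x ^ q) k = A.kerDim x k :=
    fun x hx k => kerDim_zpow hu hq (ne_of_mem_of_not_mem hx h0) (fun ν hν h =>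
      injOn_zpow_of_map_zpow_eq hcop.symm h0 hA.symm (mem_eigenMultiset_iff.2 hν) hx h) k
  rw [isConj_iff_intertwined, intertwined_iff_kerDim]
  constructor
  · intro h x hx y hy hxy
    funext k
    rw [← hpk y hy, ← hqk x hx, hxy, h]
  · intro h μ k
    -- Outside both spectra both dimensions vanish. Otherwise the multiset identity writes μ as y^p
    -- = x^q with eigenvalues x, y of A.
    by_cases hμp : μ ∈ spectrum ℂ (A ^ p)
    · obtain ⟨y, hy, rfl⟩ := exists_zpow_eq_of_mem_spectrum_zpow hu hp hμp
      rw [← mem_eigenMultiset_iff] at hy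
      have := Multiset.mem_map_of_mem (fun x => x ^ p) hy
      rw [hA, Multiset.mem_map] at this
      obtain ⟨x, hx, hxy⟩ := this
      rw [hpk y hy, ← hxy, hqk x hx, h x hx y hy hxy]
    · by_cases hμq : μ ∈ spectrum ℂ (A ^ q)
      · obtain ⟨x, hx, rfl⟩ := exists_zpow_eq_of_mem_spectrum_zpow hu hq hμq
        rw [← mem_eigenMultiset_iff] at hx
        have := Multiset.mem_map_of_mem (fun x => x ^ q) hx
        rw [← hA, Multiset.mem_map] at this
        obtain ⟨y, hy, hxy⟩ := this
        rw [hqk x hx, ← hxy, hpk y hy, h x hx y hy hxy.symm]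
      · rw [kerDim_eq_zero_of_notMem_spectrum hμp, kerDim_eq_zero_of_notMem_spectrum hμq]

theorem JordanDecomposition.uniformOnOrbits_iff_kerDimCompatible (J : JordanDecomposition A)
    (hcop : IsCoprime p q)
    (hA : (eigenMultiset A).map (fun x => x ^ p) = (eigenMultiset A).map (fun x => x ^ q))
    (hu : IsUnit A) : J.UniformOnOrbits p q ↔ KerDimCompatible A p q := by
  have h0 := zero_notMem_eigenMultiset hu
  constructor
  · intro h x hx y hy hxy
    obtain ⟨s, hs, rfl⟩ := exists_isOrbitSeq hA hx
    -- Injectivity of the p-th power forces the successor of x in its orbit to be y.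
    have hy2 : s 2 = y :=
      injOn_zpow_of_map_zpow_eq hcop h0 hA (hs 2).1 hy ((hs 1).2.symm.trans hxy)
    obtain ⟨r, -, hr⟩ := h _ ⟨s 1, hx, rfl⟩
    obtain ⟨k, hk⟩ := J.exists_ev_eq (mem_eigenMultiset_iff.1 hx)
    obtain ⟨l, hl⟩ := J.exists_ev_eq (mem_eigenMultiset_iff.1 hy)
    have hperm := (hr k l ⟨s, hs, rfl, 0, hk.symm⟩ ⟨s, hs, rfl, 1, hy2.trans hl.symm⟩).2.2
    funext t
    rw [← hk, ← hl]
    exact ((J.perm_blocks_iff k l).1 hperm t).symm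
  · rintro h O ⟨x, -, rfl⟩
    have hcount : ∀ y ∈ powerOrbit p q (eigenMultiset A) x,
        (eigenMultiset A).count y = (eigenMultiset A).count x := fun y hy =>
      eq_of_mem_powerOrbit (g := fun z => (eigenMultiset A).count z)
        (fun _ hx _ hy => count_eq_of_zpow_eq hcop h0 hA hx hy) hy
    refine ⟨(eigenMultiset A).count x, hcount, fun k l hk hl => ⟨?_, ?_, ?_⟩⟩
    · rw [← J.count_ev, hcount _ hk]
    · rw [← J.count_ev, hcount _ hl]
    · rw [J.perm_blocks_iff]
      intro t
      rw [eq_of_mem_powerOrbit h hk, eq_of_mem_powerOrbit h hl]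

end

/-! ### Splitting off the nilpotent part. -/

section splitting

theorem Matrix.exists_intertwined_fromBlocks {n : Type*} [Fintype n] [DecidableEq n]
    (A : Matrix n n ℂ) :
    ∃ (m k : ℕ) (A' : Matrix (Fin m) (Fin m) ℂ) (N : Matrix (Fin k) (Fin k) ℂ)
      (κ : Type) (_ : Fintype κ) (_ : DecidableEq κ) (e : κ → ℕ),
      Intertwined A (fromBlocks A' 0 0 N) ∧ IsUnit A' ∧
      Intertwined N (jordanMatrix (fun _ => 0) e) := by
  classical
  obtain ⟨ι, _, _, ev, e, h⟩ := exists_intertwined_jordanMatrix A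
  let B := jordanMatrix (fun i : {i // ev i ≠ 0} => ev i) fun i => e i
  let C := jordanMatrix (fun _ : {i // ¬ ev i ≠ 0} => (0 : ℂ)) fun i => e i
  let B' := reindex (Fintype.equivFin _) (Fintype.equivFin _) B
  let C' := reindex (Fintype.equivFin _) (Fintype.equivFin _) C
  have hB : Intertwined B' B := intertwined_reindex _ B
  have hC : Intertwined C' C := intertwined_reindex _ C
  refine ⟨_, _, B', C', _, inferInstance, inferInstance, _,
    h.trans (intertwined_iff_kerDim.2 fun μ k => ?_), ?_, hC⟩
  · rw [kerDim_fromBlocks, hB.kerDim_eq, hC.kerDim_eq, kerDim_jordanMatrix, kerDim_jordanMatrix,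
      kerDim_jordanMatrix, ← Fintype.sum_subtype_add_sum_subtype fun i => ev i ≠ 0]
    congr 1
    refine Finset.sum_congr rfl fun i _ => ?_
    rw [not_ne_iff.1 i.2]
  · rw [← spectrum.zero_notMem_iff ℂ, ← kerDim_one_eq_zero_iff, hB.kerDim_eq, kerDim_jordanMatrix]
    exact Finset.sum_eq_zero fun i _ => if_neg i.2

/-- The two dimensions are the sums of min(e_i, p) and of min(e_i, q). Termwise comparison forces
equality in each term, so p < q gives e_i ≤ p for every block. -/
theorem Matrix.pow_eq_zero_of_kerDim_eq {n κ : Type*} [Fintype n] [DecidableEq n] [Fintype κ]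
    [DecidableEq κ] {N : Matrix n n ℂ} {e : κ → ℕ}
    (h : Intertwined N (jordanMatrix (fun _ => 0) e)) {p q : ℕ} (hpq : p < q)
    (hk : N.kerDim 0 p = N.kerDim 0 q) : N ^ p = 0 := by
  rw [h.kerDim_eq, h.kerDim_eq, kerDim_jordanMatrix, kerDim_jordanMatrix] at hk
  simp only [if_true] at hk
  have he := (Finset.sum_eq_sum_iff_of_le fun i _ => min_le_min_left (e i) hpq.le).1 hk
  rw [← kerDim_zero_eq_card_iff, h.kerDim_eq, kerDim_jordanMatrix, ← h.card_eq, Fintype.card_sigma]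
  refine Finset.sum_congr rfl fun i hi => ?_
  have := he i hi
  rw [if_pos rfl, Fintype.card_fin]
  omega

variable {l m n : Type*} [Fintype l] [DecidableEq l] [Fintype m] [DecidableEq m] [Fintype n]
  [DecidableEq n] {A : Matrix l l ℂ} {A' : Matrix m m ℂ} {N : Matrix n n ℂ}

theorem Matrix.Intertwined.kerDim_pow_fromBlocks (h : Intertwined A (fromBlocks A' 0 0 N)) (r : ℕ)
    (μ : ℂ) (k : ℕ) :
    (A ^ r).kerDim μ k = (A' ^ r).kerDim μ k + (N ^ r).kerDim μ k := by
  rw [(h.pow r).kerDim_eq, fromBlocks_diagonal_pow, kerDim_fromBlocks]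

theorem Matrix.Intertwined.isConj_pow_iff_of_fromBlocks (h : Intertwined A (fromBlocks A' 0 0 N))
    {p q : ℕ} (hpq : p ≤ q) (hN : N ^ p = 0) :
    IsConj (A ^ p) (A ^ q) ↔ IsConj (A' ^ p) (A' ^ q) := by
  have hN' : N ^ q = 0 := pow_eq_zero_of_le hpq hN
  simp only [isConj_iff_intertwined, intertwined_iff_kerDim, h.kerDim_pow_fromBlocks, hN, hN',
    Nat.add_right_cancel_iff]

end splitting

theorem eq_zero_of_mem_eigenMultiset {n : ℕ} {N : Matrix (Fin n) (Fin n) ℂ} {p : ℕ}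
    (hN : N ^ p = 0) {x : ℂ} (hx : x ∈ eigenMultiset N) : x = 0 := by
  rw [mem_eigenMultiset_iff] at hx
  have : Nonempty (Fin n) := by
    by_contra h
    rw [not_nonempty_iff] at h
    simp [spectrum.of_subsingleton] at hx
  have h1 := spectrum.pow_mem_pow N p hx
  rw [hN, spectrum.zero_eq] at h1
  exact eq_zero_of_pow_eq_zero h1

theorem eigenMultiset_of_intertwined {l m n : ℕ} {A : Matrix (Fin l) (Fin l) ℂ}
    {A' : Matrix (Fin m) (Fin m) ℂ} {N : Matrix (Fin n) (Fin n) ℂ}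
    (h : Intertwined A (fromBlocks A' 0 0 N)) :
    eigenMultiset A = eigenMultiset A' + eigenMultiset N := by
  rw [eigenMultiset, h.charpoly_eq, charpoly_fromBlocks_zero₁₂, roots_mul
    (mul_ne_zero A'.charpoly_monic.ne_zero N.charpoly_monic.ne_zero)]
  rfl

theorem ne_zero_of_isCoprime_of_two_lt {p q : ℤ} (hcop : IsCoprime p q) (hpq : 2 < |p| + |q|) :
    p ≠ 0 := by
  rintro rfl
  rw [isCoprime_zero_left, Int.isUnit_iff] at hcop
  rcases hcop with rfl | rfl <;> simp at hpq

theorem mainTheorem1 (n : ℕ) (p q : ℤ) (hcop : IsCoprime p q) (hpq : 2 < |p| + |q|)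
    (A : Matrix (Fin n) (Fin n) ℂ)
    (hA : (eigenMultiset A).map (fun x => x ^ p) = (eigenMultiset A).map (fun x => x ^ q)) :
    (IsUnit A →
      Nonempty (JordanDecomposition A) ∧
      ∀ J : JordanDecomposition A, IsConj (A ^ p) (A ^ q) ↔ J.UniformOnOrbits p q) ∧
    (¬ IsUnit A → 1 ≤ p → p < q →
      (IsConj (A ^ p) (A ^ q) ↔
        ∃ (m k : ℕ) (hmk : m + k = n) (P : GL (Fin n) ℂ)
          (A' : Matrix (Fin m) (Fin m) ℂ) (N : Matrix (Fin k) (Fin k) ℂ),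
          A = (P : Matrix (Fin n) (Fin n) ℂ) *
              Matrix.reindex (finSumFinEquiv.trans (finCongr hmk))
                (finSumFinEquiv.trans (finCongr hmk)) (Matrix.fromBlocks A' 0 0 N) *
              ((P⁻¹ : GL (Fin n) ℂ) : Matrix (Fin n) (Fin n) ℂ) ∧
          IsUnit A' ∧
          (eigenMultiset A').map (fun x => x ^ p) = (eigenMultiset A').map (fun x => x ^ q) ∧
          (∃ J : JordanDecomposition A', J.UniformOnOrbits p q) ∧
          N ^ p = 0)) := by
  have hp0 := ne_zero_of_isCoprime_of_two_lt hcop hpq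
  have hq0 := ne_zero_of_isCoprime_of_two_lt hcop.symm (by rwa [add_comm])
  -- Stated for every size, as it is needed for A in (i) and for A' in (ii).
  have huni : ∀ {m : ℕ} {B : Matrix (Fin m) (Fin m) ℂ},
      (eigenMultiset B).map (fun x => x ^ p) = (eigenMultiset B).map (fun x => x ^ q) →
      IsUnit B → ∀ J : JordanDecomposition B, IsConj (B ^ p) (B ^ q) ↔ J.UniformOnOrbits p q :=
    fun hB hu J => (isConj_zpow_iff_kerDimCompatible hcop hp0 hq0 hB hu).trans
      (J.uniformOnOrbits_iff_kerDimCompatible hcop hB hu).symm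
  refine ⟨fun hu => ⟨nonempty_jordanDecomposition A, huni hA hu⟩, fun _ hp hlt => ?_⟩
  lift p to ℕ using by omega
  lift q to ℕ using by omega
  have hlt' : p < q := by exact_mod_cast hlt
  constructor
  · intro hconj
    obtain ⟨m, k, A', N, κ, _, _, e, hint, hu, hN⟩ := exists_intertwined_fromBlocks A
    have hmk : m + k = n := by simpa using hint.card_eq
    simp only [zpow_natCast] at hconj
    have hNp : N ^ p = 0 := by
      refine pow_eq_zero_of_kerDim_eq hN hlt' ?_
      -- At μ = 0 with exponent 1 this compares dim ker A^p with dim ker A^q; the invertible block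
      -- contributes nothing.
      have h1 := (isConj_iff_intertwined.1 hconj).kerDim_eq 0 1
      rw [kerDim_pow_zero_one, kerDim_pow_zero_one, hint.kerDim_eq, hint.kerDim_eq,
        kerDim_fromBlocks, kerDim_fromBlocks] at h1
      have h2 := spectrum.zero_notMem ℂ hu
      simpa only [kerDim_eq_zero_of_notMem_spectrum h2, zero_add] using h1
    have hA' : (eigenMultiset A').map (fun x => x ^ (p : ℤ))
        = (eigenMultiset A').map (fun x => x ^ (q : ℤ)) := by
      rw [eigenMultiset_of_intertwined hint, Multiset.map_add, Multiset.map_add] at hA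
      -- All eigenvalues of N are 0 and p, q ≠ 0, so N contributes the same zeros to both sides and
      -- cancels.
      have hz : (eigenMultiset N).map (fun x => x ^ (p : ℤ))
          = (eigenMultiset N).map (fun x => x ^ (q : ℤ)) := by
        refine Multiset.map_congr rfl fun x hx => ?_
        rw [eq_zero_of_mem_eigenMultiset hNp hx, _root_.zero_zpow _ hp0, _root_.zero_zpow _ hq0]
      rw [hz] at hA
      exact add_right_cancel hA
    obtain ⟨P, hP⟩ := hint.exists_conj (finSumFinEquiv.trans (finCongr hmk))
    obtain ⟨J⟩ := nonempty_jordanDecomposition A'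
    refine ⟨m, k, hmk, P, A', N, hP, hu, hA', ⟨J, (huni hA' hu J).1 ?_⟩, ?_⟩
    · simpa only [zpow_natCast] using (hint.isConj_pow_iff_of_fromBlocks hlt'.le hNp).1 hconj
    · simpa only [zpow_natCast] using hNp
  · rintro ⟨m, k, hmk, P, A', N, hP, hu, hA', ⟨J, hJ⟩, hN⟩
    have hint : Intertwined A (fromBlocks A' 0 0 N) := by
      rw [hP]
      exact (intertwined_conj P _).trans (intertwined_reindex _ _)
    have hconj := (huni hA' hu J).2 hJ
    simp only [zpow_natCast] at hN hconj ⊢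
    exact (hint.isConj_pow_iff_of_fromBlocks hlt'.le hN).2 hconj
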